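/- Graphs are finite; loops and multiple edges are allowed. For a graph $W$ with edge set $E_W$ let $\Lambda_W=\{0,1\}^{E_W}$; a state $\epsilon\in\Lambda_W$ is connected if the graph with all vertices of $W$ and exactly the edges $e$ with $\epsilon(e)=1$ is connected. For $(p_e)\in[0,1]^{E_W}$ the classical reliability is $R_W((p_e))=\sum_{\epsilon\text{ connected}}\prod_e p_e^{\epsilon(e)}(1-p_e)^{1-\epsilon(e)}$. Let $q\Lambda_W=S/U(1)$, where $S$ is the unit sphere of $l^2_{\mathbb C}(\Lambda_W)$, with projection $\pi:S\to q\Lambda_W$. A quantum reliability on $W$ is a smooth function $f:q\Lambda_W\to[0,1]$ such that (i) $f\big(\pi\big(\bigotimes_{e}(p_e^{1/2}|1_e\rangle+(1-p_e)^{1/2}z_e|0_e\rangle)\big)\big)=R_W((p_e))$ for all $p_e\in[0,1]$, $z_e\in U(1)$; and (ii) $f\big(\pi(p^{1/2}|\zeta\rangle+(1-p)^{1/2}z|\chi\rangle)\big)=p$ for every connected $\zeta\in\Lambda_W$, every non-connected $\chi\in\Lambda_W$, $p\in[0,1]$ and $z\in U(1)$. There is exactly one self-adjoint operator $\widehat{QR}_W$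 on $l^2_{\mathbb C}(\Lambda_W)$ for which $\pi(|\psi\rangle)\mapsto\langle\psi|\widehat{QR}_W|\psi\rangle$ is a quantum reliability; denote this quantum reliability by $QR_W$. A hybrid network is a graph $G$ whose edges are each declared quantum or classical. Let $K$ and $H$ be the smallest subgraphs of $G$ containing all quantum edges and all classical edges, respectively, and let $U=V(K)\cap V(H)$. A hybrid state is a pair $\zeta=(\zeta_K,(p_e)_{e\in E_H})\in q\Lambda_K\times[0,1]^{E_H}$, and $QR_G(\zeta)$ is defined as the value of $QR_G$ at the quantum state represented by $|\psi\rangle\otimes\bigotimes_{e\in E_H}(p_e^{1/2}|1_e\rangle+(1-p_e)^{1/2}|0_e\rangle)$, where $|\psi\rangle$ is a unit vector representing $\zeta_K$. Let $\Gamma(U)$ be the set of partitions of $U$; for $\gamma,\gamma'\in\Gamma(U)$ let $\alpha_{\gamma,\gamma'}=1$ if the finest common coarsening of $\gamma$ and $\gamma'$ has a single block, and $\alpha_{\gamma,\gamma'}=0$ otherwise. For $W\in\{K,H\}$ let $W/\gamma$ be obtained from $W$ by identifying the vertices in each block of $\gamma$; it has the same edge set as $W$. **Corollary.** Let $G$ be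 a hybrid network such that every vertex of $G$ is an end of some edge and $U\neq\emptyset$. Then the matrix $(\alpha_{\gamma,\gamma'})$ is invertible and, with $(\beta_{\gamma,\gamma'})=(\alpha_{\gamma,\gamma'})^{-1}$, for every hybrid state $\zeta=(\zeta_K,(p_e)_{e\in E_H})$, $$QR_G(\zeta)=\sum_{\gamma,\gamma'\in\Gamma(U)}\beta_{\gamma,\gamma'}\,QR_{K/\gamma}(\zeta_K)\,R_{H/\gamma'}\big((p_e)_{e\in E_H}\big).$$ -/

import Mathlib

open scoped Graph ContDiff InnerProductSpace

namespace QuantumNetwork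

universe u v

variable {α : Type u} {β : Type v}

/-! ### Classical networks -/

/-- A (multi)graph is connected if it has a vertex and any two vertices are joined by a path. -/
def IsConnected (G : Graph α β) : Prop :=
  V(G).Nonempty ∧ ∀ x ∈ V(G), ∀ y ∈ V(G), Relation.ReflTransGen G.Adj x y

noncomputable instance instFintypeEdges (G : Graph α β) [Finite E(G)] : Fintype E(G) :=
  Fintype.ofFinite _

/-- The set `Λ_G = {0,1}^E` of classical states of `G`. -/
def ClassicalState (G : Graph α β) : Type v := E(G) → Bool

open Classical in
noncomputable instance (G : Graph α β) [Finite E(G)] : Fintype (ClassicalState G) :=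
  inferInstanceAs (Fintype (E(G) → Bool))

/-- The graph `G(ε)`: all vertices of `G`, and the edges that operate in the state `ε`. -/
def operatingGraph (G : Graph α β) (ε : ClassicalState G) : Graph α β :=
  G.restrict {e | ∃ he : e ∈ E(G), ε ⟨e, he⟩ = true}

/-- A classical state is connected if the graph of its operating edges is. -/
def IsConnectedState (G : Graph α β) (ε : ClassicalState G) : Prop :=
  IsConnected (operatingGraph G ε)

/-- The probability of the state `ε` for independent Bernoulli edges. -/
noncomputable def stateProb (G : Graph α β) [Finite E(G)] (p : E(G) → unitInterval)
    (ε : ClassicalState G) : ℝ :=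
  ∏ e, if ε e = true then (p e : ℝ) else 1 - (p e : ℝ)

open Classical in
/-- The classical reliability `R_G`: the probability that the state is connected. -/
noncomputable def classicalReliability (G : Graph α β) [Finite E(G)]
    (p : E(G) → unitInterval) : ℝ :=
  ∑ ε : ClassicalState G, if IsConnectedState G ε then stateProb G p ε else 0

/-! ### Quantum states -/

/-- The Hermitian space `l²_ℂ(Λ_G)`. -/
abbrev StateSpace (G : Graph α β) : Type v := EuclideanSpace ℂ (ClassicalState G)

/-- The unit sphere of `l²_ℂ(Λ_G)`. -/
abbrev UnitVector (G : Graph α β) [Finite E(G)] : Type v :=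
  Metric.sphere (0 : StateSpace G) 1

open Classical in
/-- The basis vector `|ε⟩`. -/
noncomputable def ket (G : Graph α β) (ε : ClassicalState G) : StateSpace G :=
  EuclideanSpace.single ε 1

/-- Two unit vectors are equivalent if they differ by a scalar (necessarily a phase). -/
def phaseSetoid (G : Graph α β) [Finite E(G)] : Setoid (UnitVector G) where
  r a b := ∃ z : ℂ, (a : StateSpace G) = z • (b : StateSpace G)
  iseqv :=
    { refl := fun a => ⟨1, by simp⟩
      symm := by
        rintro a b ⟨z, hz⟩
        have hz0 : z ≠ 0 := by
          rintro rfl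
          have ha : ‖(a : StateSpace G)‖ = 1 := norm_eq_of_mem_sphere a
          rw [hz] at ha
          simp at ha
        exact ⟨z⁻¹, by rw [hz, smul_smul, inv_mul_cancel₀ hz0, one_smul]⟩
      trans := by
        rintro a b c ⟨z, hz⟩ ⟨w, hw⟩
        exact ⟨z * w, by rw [hz, hw, smul_smul]⟩ }

/-- The set `qΛ_G` of quantum states. -/
def QuantumState (G : Graph α β) [Finite E(G)] : Type v := Quotient (phaseSetoid G)

/-- The projection `π` from the unit sphere onto the set of quantum states. -/
def toState {G : Graph α β} [Finite E(G)] (ψ : UnitVector G) : QuantumState G :=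
  Quotient.mk (phaseSetoid G) ψ

/-- The unit vector `v / ‖v‖`. -/
noncomputable def normalize {G : Graph α β} [Finite E(G)] (v : StateSpace G) (hv : v ≠ 0) :
    UnitVector G :=
  ⟨‖v‖⁻¹ • v, by
    rw [mem_sphere_zero_iff_norm, norm_smul, norm_inv, norm_norm,
      inv_mul_cancel₀ (norm_ne_zero_iff.2 hv)]⟩

open Classical in
/-- Smoothness of a function on the projective space `qΛ_G`: the function that it induces on the
nonzero vectors of `l²_ℂ(Λ_G)`, a submersion onto `qΛ_G`, is smooth. -/
def IsSmooth (G : Graph α β) [Finite E(G)] (f : QuantumState G → ℝ) : Prop :=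
  ContDiffOn ℝ ∞ (fun v : StateSpace G => if hv : v = 0 then 0 else f (toState (normalize v hv)))
    {0}ᶜ

/-- The coordinates of the qubit `p^{1/2} |1⟩ + (1-p)^{1/2} z |0⟩`. -/
noncomputable def qubit (p : unitInterval) (z : Circle) (b : Bool) : ℂ :=
  if b = true then ((√(p : ℝ) : ℝ) : ℂ) else ((√(1 - (p : ℝ)) : ℝ) : ℂ) * (z : ℂ)

/-- The tensor product over the edges of the qubits with parameters `p e` and `z e`. -/
noncomputable def qubitProduct (G : Graph α β) [Finite E(G)] (p : E(G) → unitInterval)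
    (z : E(G) → Circle) : StateSpace G :=
  WithLp.toLp 2 fun ε => ∏ e, qubit (p e) (z e) (ε e)

/-! ### Quantum reliability -/

/-- Quantum reliabilities on `G`. As `f` is a function on `qΛ_G`, global phases play no role. -/
structure IsQuantumReliability (G : Graph α β) [Finite E(G)] (f : QuantumState G → ℝ) :
    Prop where
  smooth : IsSmooth G f
  mem_Icc : ∀ x, f x ∈ Set.Icc (0 : ℝ) 1
  extension : ∀ (p : E(G) → unitInterval) (z : E(G) → Circle) (ψ : UnitVector G),
    (ψ : StateSpace G) = qubitProduct G p z → f (toState ψ) = classicalReliability G p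
  entanglement : ∀ ζ χ : ClassicalState G, IsConnectedState G ζ → ¬ IsConnectedState G χ →
    ∀ (p : unitInterval) (z : Circle) (ψ : UnitVector G),
      (ψ : StateSpace G) = qubit p z true • ket G ζ + qubit p z false • ket G χ →
        f (toState ψ) = p

/-- `L` is self-adjoint and `π(ψ) ↦ ⟨ψ| L |ψ⟩` is a quantum reliability. -/
def IsReliabilityOperator (G : Graph α β) [Finite E(G)]
    (L : StateSpace G →L[ℂ] StateSpace G) : Prop :=
  IsSelfAdjoint L ∧ ∃ f : QuantumState G → ℝ, IsQuantumReliability G f ∧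
    ∀ ψ : UnitVector G,
      ((f (toState ψ) : ℝ) : ℂ) = ⟪(ψ : StateSpace G), L (ψ : StateSpace G)⟫_ℂ

theorem normSq_qubit_add (p : unitInterval) (z : Circle) :
    ‖qubit p z true‖ ^ 2 + ‖qubit p z false‖ ^ 2 = 1 := by
  have h0 := p.2.1
  have h1 : (0 : ℝ) ≤ 1 - p := sub_nonneg.2 p.2.2
  have hz : ‖(z : ℂ)‖ = 1 := Circle.norm_coe z
  simp [qubit, hz, Real.sq_sqrt h0, Real.sq_sqrt h1]

theorem normSq_qubit (p : unitInterval) (z : Circle) (b : Bool) :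
    ‖qubit p z b‖ ^ 2 = if b = true then (p : ℝ) else 1 - (p : ℝ) := by
  have h0 := p.2.1
  have h1 : (0 : ℝ) ≤ 1 - p := sub_nonneg.2 p.2.2
  have hz : ‖(z : ℂ)‖ = 1 := Circle.norm_coe z
  cases b <;> simp [qubit, hz, Real.sq_sqrt h0, Real.sq_sqrt h1]

theorem sum_normSq_qubits (G : Graph α β) [Finite E(G)] (p : E(G) → unitInterval)
    (z : E(G) → Circle) :
    ∑ ε : ClassicalState G, ∏ e, ‖qubit (p e) (z e) (ε e)‖ ^ 2 = 1 := by
  classical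
  have h := (Finset.prod_univ_sum (fun _ : E(G) => (Finset.univ : Finset Bool))
    (fun e b => ‖qubit (p e) (z e) b‖ ^ 2)).symm
  rw [Fintype.piFinset_univ] at h
  refine Eq.trans ?_ (h.trans ?_)
  · rfl
  · refine Finset.prod_eq_one fun e _ => ?_
    rw [Fintype.sum_bool]
    exact normSq_qubit_add _ _

theorem norm_qubitProduct (G : Graph α β) [Finite E(G)] (p : E(G) → unitInterval)
    (z : E(G) → Circle) : ‖qubitProduct G p z‖ = 1 := by
  rw [← sq_eq_sq₀ (norm_nonneg _) zero_le_one, EuclideanSpace.norm_sq_eq, one_pow,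
    ← sum_normSq_qubits G p z]
  refine Finset.sum_congr rfl fun ε _ => ?_
  simp only [qubitProduct, norm_prod, Finset.prod_pow]

theorem norm_ket (G : Graph α β) [Finite E(G)] (ε : ClassicalState G) : ‖ket G ε‖ = 1 := by
  simp [ket]

theorem inner_ket_ket (G : Graph α β) [Finite E(G)] (ε ε' : ClassicalState G) (h : ε ≠ ε') :
    ⟪ket G ε, ket G ε'⟫_ℂ = 0 := by
  classical
  simp [ket, EuclideanSpace.inner_single_left, h]

theorem norm_superposition (G : Graph α β) [Finite E(G)] (ε ε' : ClassicalState G)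
    (h : ε ≠ ε') (p : unitInterval) (z : Circle) :
    ‖qubit p z true • ket G ε + qubit p z false • ket G ε'‖ = 1 := by
  rw [← sq_eq_sq₀ (norm_nonneg _) zero_le_one, @norm_add_sq ℂ, inner_smul_left, inner_smul_right,
    inner_ket_ket G ε ε' h, norm_smul, norm_smul, norm_ket, norm_ket, one_pow]
  simpa using normSq_qubit_add p z

open Classical in
/-- The orthogonal projection onto the span of the connected classical states. -/
noncomputable def connectedProjection (G : Graph α β) [Finite E(G)] :
    StateSpace G →L[ℂ] StateSpace G :=
  LinearMap.toContinuousLinearMap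
    { toFun := fun ψ => WithLp.toLp 2 fun ε => if IsConnectedState G ε then ψ ε else 0
      map_add' := fun x y => by
        ext ε
        by_cases h : IsConnectedState G ε <;> simp [h]
      map_smul' := fun c x => by
        ext ε
        by_cases h : IsConnectedState G ε <;> simp [h] }

open Classical in
theorem connectedProjection_apply (G : Graph α β) [Finite E(G)] (ψ : StateSpace G)
    (ε : ClassicalState G) :
    connectedProjection G ψ ε = if IsConnectedState G ε then ψ ε else 0 := rfl

open Classical in
theorem inner_connectedProjection (G : Graph α β) [Finite E(G)] (ψ : StateSpace G) :
    ⟪ψ, connectedProjection G ψ⟫_ℂ =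
      ((∑ ε, if IsConnectedState G ε then ‖ψ ε‖ ^ 2 else 0 : ℝ) : ℂ) := by
  rw [PiLp.inner_apply, Complex.ofReal_sum]
  refine Finset.sum_congr rfl fun ε _ => ?_
  rw [connectedProjection_apply]
  by_cases h : IsConnectedState G ε
  · simp only [h, if_true, inner_self_eq_norm_sq_to_K]
    simp
  · simp [h]

theorem isSelfAdjoint_connectedProjection (G : Graph α β) [Finite E(G)] :
    IsSelfAdjoint (connectedProjection G) := by
  classical
  rw [ContinuousLinearMap.isSelfAdjoint_iff_isSymmetric]
  intro x y
  simp only [ContinuousLinearMap.coe_coe, PiLp.inner_apply, connectedProjection_apply]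
  refine Finset.sum_congr rfl fun ε _ => ?_
  by_cases h : IsConnectedState G ε <;> simp [h]

/-- The function `⟨ψ| L |ψ⟩` on `qΛ_G` (real part, which is all of it for self-adjoint `L`). -/
noncomputable def expectation (G : Graph α β) [Finite E(G)]
    (L : StateSpace G →L[ℂ] StateSpace G) : QuantumState G → ℝ :=
  Quotient.lift
    (fun ψ : UnitVector G => (⟪(ψ : StateSpace G), L (ψ : StateSpace G)⟫_ℂ).re) (by
      rintro a b ⟨z, hz⟩
      have ha : ‖(a : StateSpace G)‖ = 1 := norm_eq_of_mem_sphere a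
      have hb : ‖(b : StateSpace G)‖ = 1 := norm_eq_of_mem_sphere b
      have hz1 : ‖z‖ = 1 := by
        rw [hz, norm_smul, hb, mul_one] at ha
        exact ha
      have hzz : (starRingEnd ℂ) z * z = 1 := by
        rw [Complex.conj_mul', hz1]
        simp
      have hcomm : ∀ w : ℂ, z * ((starRingEnd ℂ) z * w) = w := fun w => by
        rw [mul_left_comm, ← mul_assoc, hzz, one_mul]
      simp only [hz, map_smul, inner_smul_left, inner_smul_right, hcomm])

theorem expectation_toState (G : Graph α β) [Finite E(G)]
    (L : StateSpace G →L[ℂ] StateSpace G) (ψ : UnitVector G) :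
    expectation G L (toState ψ) = (⟪(ψ : StateSpace G), L (ψ : StateSpace G)⟫_ℂ).re := rfl

open Classical in
theorem expectation_connectedProjection (G : Graph α β) [Finite E(G)] (ψ : UnitVector G) :
    expectation G (connectedProjection G) (toState ψ) =
      ∑ ε, if IsConnectedState G ε then ‖(ψ : StateSpace G) ε‖ ^ 2 else 0 := by
  rw [expectation_toState, inner_connectedProjection, Complex.ofReal_re]

theorem isQuantumReliability_connectedProjection (G : Graph α β) [Finite E(G)] :
    IsQuantumReliability G (expectation G (connectedProjection G)) := by
  classical
  refine ⟨?_, ?_, ?_, ?_⟩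
  · have hsm : ContDiffOn ℝ ∞ (fun v : StateSpace G =>
        (∑ ε, if IsConnectedState G ε then ‖v ε‖ ^ 2 else 0) / ‖v‖ ^ 2) {0}ᶜ := by
      refine ContDiffOn.div ?_ ?_ ?_
      · refine ContDiff.contDiffOn (ContDiff.sum fun ε _ => ?_)
        by_cases h : IsConnectedState G ε
        · simp only [h, if_true]
          exact ContDiff.norm_sq ℝ
            (((EuclideanSpace.proj (𝕜 := ℂ) ε).restrictScalars ℝ).contDiff)
        · simp only [h, if_false]
          exact contDiff_const
      · exact (contDiff_norm_sq ℝ).contDiffOn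
      · intro v hv
        exact pow_ne_zero 2 (norm_ne_zero_iff.2 hv)
    refine hsm.congr fun v hv => ?_
    have hv' : v ≠ 0 := hv
    rw [dif_neg hv', expectation_connectedProjection, Finset.sum_div]
    refine Finset.sum_congr rfl fun ε _ => ?_
    by_cases h : IsConnectedState G ε
    · simp only [h, if_true, normalize, PiLp.smul_apply, norm_smul, norm_inv, norm_norm]
      rw [mul_pow, inv_pow, div_eq_inv_mul]
    · simp [h]
  · intro x
    induction x using Quotient.inductionOn with
    | h ψ =>
      change expectation G (connectedProjection G) (toState ψ) ∈ _
      rw [expectation_connectedProjection]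
      have hψ : ‖(ψ : StateSpace G)‖ = 1 := norm_eq_of_mem_sphere ψ
      constructor
      · exact Finset.sum_nonneg fun ε _ => by split_ifs <;> positivity
      · have h1 : ∑ ε, ‖(ψ : StateSpace G) ε‖ ^ 2 = 1 := by
          rw [← EuclideanSpace.norm_sq_eq, hψ, one_pow]
        refine le_trans ?_ h1.le
        exact Finset.sum_le_sum fun ε _ => by split_ifs <;> [exact le_rfl; positivity]
  · intro p z ψ hψ
    rw [expectation_connectedProjection, hψ, classicalReliability]
    refine Finset.sum_congr rfl fun ε _ => ?_
    by_cases h : IsConnectedState G ε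
    · simp only [h, if_true, qubitProduct, norm_prod, ← Finset.prod_pow, normSq_qubit, stateProb]
    · simp [h]
  · intro ζ χ hζ hχ p z ψ hψ
    have hne : ζ ≠ χ := by
      rintro rfl
      exact hχ hζ
    rw [expectation_connectedProjection, hψ, Finset.sum_eq_single ζ]
    · have := normSq_qubit p z true
      simp only [if_true] at this
      simp [hζ, ket, hne, this]
    · intro ε _ hε
      by_cases h : IsConnectedState G ε
      · have hεχ : ε ≠ χ := by
          rintro rfl
          exact hχ h
        simp [ket, hε, hεχ]
      · simp [h]
    · simp

theorem IsReliabilityOperator.eq_connectedProjection {G : Graph α β} [Finite E(G)]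
    {L : StateSpace G →L[ℂ] StateSpace G} (hL : IsReliabilityOperator G L) :
    L = connectedProjection G := by
  classical
  obtain ⟨hsa, f, hf, hfL⟩ := hL
  have hsym : ∀ x y, ⟪L x, y⟫_ℂ = ⟪x, L y⟫_ℂ :=
    (ContinuousLinearMap.isSelfAdjoint_iff_isSymmetric.1 hsa)
  -- diagonal coefficients
  have hdiag : ∀ ε, ⟪ket G ε, L (ket G ε)⟫_ℂ = if IsConnectedState G ε then 1 else 0 := by
    intro ε
    have hprod : ∀ ε' : ClassicalState G,
        ∏ e, (if ε' e = true then (if ε e = true then (1 : ℝ) else 0)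
          else 1 - (if ε e = true then (1 : ℝ) else 0)) = if ε' = ε then 1 else 0 := by
      intro ε'
      by_cases h : ε' = ε
      · subst h
        rw [if_pos rfl]
        refine Finset.prod_eq_one fun e _ => ?_
        by_cases he : ε' e = true <;> simp [he]
      · rw [if_neg h]
        obtain ⟨e, he⟩ := Function.ne_iff.1 h
        refine Finset.prod_eq_zero (Finset.mem_univ e) ?_
        cases h1 : ε' e <;> cases h2 : ε e <;> simp_all
    have hket : ket G ε = qubitProduct G (fun e => if ε e = true then 1 else 0) (fun _ => 1) := by
      ext ε'
      have hq : ∀ e, qubit (if ε e = true then 1 else 0) 1 (ε' e) =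
          (((if ε' e = true then (if ε e = true then (1 : ℝ) else 0)
          else 1 - (if ε e = true then (1 : ℝ) else 0)) : ℝ) : ℂ) := by
        intro e
        cases h1 : ε' e <;> cases h2 : ε e <;> simp [qubit]
      simp only [qubitProduct, hq]
      rw [← Complex.ofReal_prod, hprod]
      by_cases h : ε' = ε <;> simp [ket, h]
    have h1 := hf.extension _ _ ⟨ket G ε, by simp [norm_ket]⟩ hket
    have h2 := hfL ⟨ket G ε, by simp [norm_ket]⟩
    rw [← h2, h1, classicalReliability]
    have h3 : ∀ ε', stateProb G (fun e => if ε e = true then 1 else 0) ε' =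
        if ε' = ε then 1 else 0 := by
      intro ε'
      rw [← hprod ε', stateProb]
      refine Finset.prod_congr rfl fun e _ => ?_
      cases h1 : ε' e <;> cases h2 : ε e <;> simp
    simp only [h3]
    rw [Finset.sum_eq_single ε]
    · by_cases h : IsConnectedState G ε <;> simp [h]
    · intro ε' _ h
      simp [h]
    · simp
  -- values on superpositions
  have hval : ∀ ε ε', ε ≠ ε' → ∀ z : Circle, ∃ x : QuantumState G,
      ((f x : ℝ) : ℂ) = (1 / 2 : ℂ) * (⟪ket G ε, L (ket G ε)⟫_ℂ + ⟪ket G ε', L (ket G ε')⟫_ℂ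
        + z * ⟪ket G ε, L (ket G ε')⟫_ℂ
        + (starRingEnd ℂ) (z * ⟪ket G ε, L (ket G ε')⟫_ℂ)) ∧
      ((IsConnectedState G ε ∧ ¬ IsConnectedState G ε') → f x = 1 / 2) := by
    intro ε ε' hne z
    let p : unitInterval := ⟨1 / 2, by norm_num, by norm_num⟩
    let ψ : UnitVector G := ⟨qubit p z true • ket G ε + qubit p z false • ket G ε', by
      rw [mem_sphere_zero_iff_norm]
      exact norm_superposition G ε ε' hne p z⟩
    refine ⟨toState ψ, ?_, ?_⟩
    · rw [hfL ψ]
      have hs : ((√(1 / 2 : ℝ) : ℝ) : ℂ) * ((√(1 / 2 : ℝ) : ℝ) : ℂ) = 1 / 2 := by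
        rw [← Complex.ofReal_mul, Real.mul_self_sqrt (by norm_num)]
        norm_num
      have hq1 : qubit p z true = ((√(1 / 2 : ℝ) : ℝ) : ℂ) := by simp [qubit, p]
      have hq2 : qubit p z false = ((√(1 / 2 : ℝ) : ℝ) : ℂ) * z := by
        have : (1 : ℝ) - 1 / 2 = 1 / 2 := by norm_num
        simp only [qubit, p, this]
        simp
      have hzz : (starRingEnd ℂ) (z : ℂ) * z = 1 := by
        rw [Complex.conj_mul', Circle.norm_coe]
        simp
      have hconj : ⟪ket G ε', L (ket G ε)⟫_ℂ = (starRingEnd ℂ) ⟪ket G ε, L (ket G ε')⟫_ℂ := by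
        rw [inner_conj_symm, hsym]
      simp only [ψ, map_add, map_smul, inner_add_left, inner_add_right, inner_smul_left,
        inner_smul_right, hq1, hq2, map_mul, Complex.conj_ofReal, hconj]
      generalize ((√(1 / 2 : ℝ) : ℝ) : ℂ) = s at hs
      generalize ⟪ket G ε, L (ket G ε')⟫_ℂ = c
      generalize ⟪ket G ε, L (ket G ε)⟫_ℂ = a
      generalize ⟪ket G ε', L (ket G ε')⟫_ℂ = b
      generalize (starRingEnd ℂ) (z : ℂ) = w at *
      generalize (z : ℂ) = y at *
      generalize (starRingEnd ℂ) c = d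
      linear_combination (a + b * (w * y) + y * c + w * d) * hs + (1 / 2) * b * hzz
    · rintro ⟨h1, h2⟩
      have := hf.entanglement ε ε' h1 h2 p z ψ rfl
      rw [this]
  -- off-diagonal coefficients
  have hoff : ∀ ε ε', ε ≠ ε' → (IsConnectedState G ε' → IsConnectedState G ε) →
      ⟪ket G ε, L (ket G ε')⟫_ℂ = 0 := by
    intro ε ε' hne himp
    by_contra hc
    set c := ⟪ket G ε, L (ket G ε')⟫_ℂ with hcdef
    have hcn : 0 < ‖c‖ := norm_pos_iff.2 hc
    have hcc : (‖c‖ : ℂ) ≠ 0 := by exact_mod_cast hcn.ne'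
    let z : Circle := ⟨(starRingEnd ℂ) c / ‖c‖, by
      rw [Submonoid.unitSphere, Submonoid.mem_mk, Subsemigroup.mem_mk, mem_sphere_zero_iff_norm, norm_div, RCLike.norm_conj, Complex.norm_real, norm_norm,
        div_self hcn.ne']⟩
    have hz : (z : ℂ) * c = (‖c‖ : ℂ) := by
      change (starRingEnd ℂ) c / ‖c‖ * c = _
      rw [div_mul_eq_mul_div, Complex.conj_mul', pow_two, mul_div_assoc, div_self hcc, mul_one]
    have hz' : ((-z : Circle) : ℂ) * c = -(‖c‖ : ℂ) := by
      rw [← hz]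
      simp
    obtain ⟨x, hx, hx'⟩ := hval ε ε' hne z
    obtain ⟨y, hy, -⟩ := hval ε ε' hne (-z)
    rw [← hcdef, hz, hdiag, hdiag] at hx
    rw [← hcdef, hz', hdiag, hdiag] at hy
    have hxI := hf.mem_Icc x
    have hyI := hf.mem_Icc y
    by_cases h1 : IsConnectedState G ε <;> by_cases h2 : IsConnectedState G ε'
    · have : f x = 1 + ‖c‖ := by
        simp only [h1, h2, if_true, Complex.conj_ofReal] at hx
        have : ((f x : ℝ) : ℂ) = ((1 + ‖c‖ : ℝ) : ℂ) := by
          rw [hx]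
          push_cast
          ring
        exact_mod_cast this
      linarith [hxI.2]
    · have : f x = 1 / 2 + ‖c‖ := by
        simp only [h1, h2, if_true, if_false, Complex.conj_ofReal] at hx
        have : ((f x : ℝ) : ℂ) = ((1 / 2 + ‖c‖ : ℝ) : ℂ) := by
          rw [hx]
          push_cast
          ring
        exact_mod_cast this
      linarith [hx' ⟨h1, h2⟩]
    · exact h1 (himp h2)
    · have : f y = -‖c‖ := by
        simp only [h1, h2, if_false, map_neg, Complex.conj_ofReal] at hy
        have : ((f y : ℝ) : ℂ) = ((-‖c‖ : ℝ) : ℂ) := by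
          rw [hy]
          push_cast
          ring
        exact_mod_cast this
      linarith [hyI.1]
  have hcoeff : ∀ ε ε', (L (ket G ε')) ε =
      if ε = ε' then (if IsConnectedState G ε then 1 else 0) else 0 := by
    intro ε ε'
    have h0 : (L (ket G ε')) ε = ⟪ket G ε, L (ket G ε')⟫_ℂ := by
      simp [ket, EuclideanSpace.inner_single_left]
    rw [h0]
    by_cases h : ε = ε'
    · subst h
      rw [hdiag, if_pos rfl]
    · rw [if_neg h]
      by_cases hi : IsConnectedState G ε' → IsConnectedState G ε
      · exact hoff ε ε' h hi
      · have h3 := hoff ε' ε (Ne.symm h) fun h4 => absurd (fun _ => h4) hi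
        rw [← hsym, ← inner_conj_symm, h3, map_zero]
  refine ContinuousLinearMap.coe_injective
    ((EuclideanSpace.basisFun (ClassicalState G) ℂ).toBasis.ext fun ε' => ?_)
  rw [OrthonormalBasis.coe_toBasis, EuclideanSpace.basisFun_apply]
  change L (ket G ε') = connectedProjection G (ket G ε')
  ext ε
  rw [hcoeff, connectedProjection_apply]
  by_cases h : ε = ε' <;> simp [h, ket]

/-- There is exactly one self-adjoint operator that induces a quantum reliability. -/
theorem existsUnique_reliabilityOperator (G : Graph α β) [Finite E(G)] :
    ∃! L : StateSpace G →L[ℂ] StateSpace G, IsReliabilityOperator G L := by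
  refine ⟨connectedProjection G, ⟨isSelfAdjoint_connectedProjection G, _,
    isQuantumReliability_connectedProjection G, fun ψ => ?_⟩, fun L hL => hL.eq_connectedProjection⟩
  rw [expectation_toState, inner_connectedProjection, Complex.ofReal_re]

/-- The quantum reliability operator: the unique self-adjoint operator that induces a quantum
reliability. -/
noncomputable def reliabilityOperator (G : Graph α β) [Finite E(G)] :
    StateSpace G →L[ℂ] StateSpace G :=
  (existsUnique_reliabilityOperator G).choose

/-- The quantum reliability `QR_G` induced by the quantum reliability operator. -/
noncomputable def quantumReliability (G : Graph α β) [Finite E(G)] : QuantumState G → ℝ :=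
  expectation G (reliabilityOperator G)

/-! ### Hybrid networks -/

/-- A hybrid network (with perfect nodes): a finite graph each of whose edges is either quantum or
classical. -/
structure HybridNetwork (α : Type u) (β : Type v) where
  graph : Graph α β
  finite_vertices : V(graph).Finite
  finite_edges : E(graph).Finite
  quantumEdges : Set β
  quantumEdges_subset : quantumEdges ⊆ E(graph)

/-- The smallest subgraph of `G` that contains the edges in `F`. -/
def edgeSubgraph (G : Graph α β) (F : Set β) : Graph α β where
  vertexSet := {x | ∃ e ∈ F, G.Inc e x}
  edgeSet := E(G) ∩ F
  IsLink e x y := e ∈ F ∧ G.IsLink e x y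
  isLink_symm := fun _ _ => { symm := fun _ _ h => ⟨h.1, h.2.symm⟩ }
  eq_or_eq_of_isLink_of_isLink := fun _ _ _ _ _ h h' => h.2.left_eq_or_eq h'.2
  edge_mem_iff_exists_isLink := fun _ =>
    ⟨fun h => (G.exists_isLink_of_mem_edgeSet h.1).imp fun _ hx => hx.imp fun _ hy => ⟨h.2, hy⟩,
      fun ⟨_, _, h⟩ => ⟨h.2.edge_mem, h.1⟩⟩
  left_mem_of_isLink := fun e _x y h => ⟨e, h.1, y, h.2⟩

namespace HybridNetwork

variable (N : HybridNetwork α β)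

/-- The quantum subgraph `K` of the canonical decomposition. -/
def quantumPart : Graph α β := edgeSubgraph N.graph N.quantumEdges

/-- The classical subgraph `H` of the canonical decomposition. -/
def classicalPart : Graph α β := edgeSubgraph N.graph (E(N.graph) \ N.quantumEdges)

/-- The set `U` of sharing nodes of the canonical decomposition. -/
def sharingNodes : Set α := V(N.quantumPart) ∩ V(N.classicalPart)

instance : Finite E(N.graph) := N.finite_edges

instance : Finite E(N.quantumPart) := N.finite_edges.subset fun _ h => h.1

instance : Finite E(N.classicalPart) := N.finite_edges.subset fun _ h => h.1

instance : Finite N.sharingNodes :=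
  N.finite_vertices.subset fun _ h => h.1.elim fun _ he => he.2.vertex_mem

/-- The set `hΛ_G = qΛ_K × [0,1]^{E_H}` of states of the hybrid network. -/
abbrev State : Type v := QuantumState N.quantumPart × (E(N.classicalPart) → unitInterval)

/-- The component of a classical state of `G` in `Λ_K`. -/
def restrictQuantum (ε : ClassicalState N.graph) : ClassicalState N.quantumPart :=
  fun e => ε ⟨e.1, e.2.1⟩

/-- The component of a classical state of `G` in `Λ_H`. -/
def restrictClassical (ε : ClassicalState N.graph) : ClassicalState N.classicalPart :=
  fun e => ε ⟨e.1, e.2.1⟩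

/-- The tensor product of vectors under `l²_ℂ(Λ_G) = l²_ℂ(Λ_K) ⊗ l²_ℂ(Λ_H)`. -/
noncomputable def tensor (ψ : StateSpace N.quantumPart) (φ : StateSpace N.classicalPart) :
    StateSpace N.graph :=
  WithLp.toLp 2 fun ε => ψ (N.restrictQuantum ε) * φ (N.restrictClassical ε)

open Classical in
/-- The factorization `Λ_G = Λ_K × Λ_H`. -/
noncomputable def stateEquiv :
    ClassicalState N.graph ≃ ClassicalState N.quantumPart × ClassicalState N.classicalPart where
  toFun ε := (N.restrictQuantum ε, N.restrictClassical ε)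
  invFun x := fun e =>
    if h : e.1 ∈ N.quantumEdges then x.1 ⟨e.1, e.2, h⟩ else x.2 ⟨e.1, e.2, e.2, h⟩
  left_inv ε := by
    funext e
    by_cases h : e.1 ∈ N.quantumEdges <;> simp [h, restrictQuantum, restrictClassical]
  right_inv x := by
    refine Prod.ext (funext fun e => ?_) (funext fun e => ?_)
    · have h : e.1 ∈ N.quantumEdges := e.2.2
      simp [h, restrictQuantum]
    · have h : e.1 ∉ N.quantumEdges := e.2.2.2
      simp [h, restrictClassical]

theorem norm_tensor (ψ : StateSpace N.quantumPart) (φ : StateSpace N.classicalPart) :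
    ‖N.tensor ψ φ‖ = ‖ψ‖ * ‖φ‖ := by
  rw [← sq_eq_sq₀ (norm_nonneg _) (by positivity), mul_pow, EuclideanSpace.norm_sq_eq,
    EuclideanSpace.norm_sq_eq, EuclideanSpace.norm_sq_eq, Finset.sum_mul_sum,
    ← Finset.sum_product', Finset.univ_product_univ]
  refine Fintype.sum_equiv N.stateEquiv _ _ fun ε => ?_
  simp only [tensor, norm_mul, mul_pow]
  rfl

/-- The quantum state of `G` represented by
`|ψ⟩ ⊗ ⨂_e (p_e^{1/2} |1_e⟩ + (1 - p_e)^{1/2} |0_e⟩)`, where `|ψ⟩` represents the quantum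
component of the hybrid state. -/
noncomputable def toQuantumState (ζ : N.State) : QuantumState N.graph :=
  Quotient.map
    (fun ψ : UnitVector N.quantumPart =>
      (⟨N.tensor ψ (qubitProduct N.classicalPart ζ.2 fun _ => 1), by
        rw [mem_sphere_zero_iff_norm, norm_tensor, norm_qubitProduct, mul_one]
        exact norm_eq_of_mem_sphere ψ⟩ : UnitVector N.graph))
    (by
      rintro a b ⟨z, hz⟩
      refine ⟨z, ?_⟩
      ext ε
      simp [tensor, hz, mul_assoc]) ζ.1

/-- The quantum reliability of a hybrid state. -/
noncomputable def reliability (ζ : N.State) : ℝ :=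
  quantumReliability N.graph (N.toQuantumState ζ)

end HybridNetwork

/-! ### Partitions of the sharing nodes -/

/-- The class of `x` when the blocks of the partition `γ` of `U` are shrunk to points: the block of
`x` if `x ∈ U`, and `{x}` otherwise. -/
def block (U : Set α) (γ : Setoid U) (x : α) : Set α :=
  {y | y = x ∨ ∃ (hx : x ∈ U) (hy : y ∈ U), γ ⟨x, hx⟩ ⟨y, hy⟩}

/-- The graph `W/γ`: the vertices in each block of the partition `γ` of `U` are identified. The
edge set of `W/γ` is that of `W`. -/
def identify (W : Graph α β) {U : Set α} (γ : Setoid U) : Graph (Set α) β :=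
  W.map (block U γ)

instance (W : Graph α β) [h : Finite E(W)] {U : Set α} (γ : Setoid U) :
    Finite E(identify W γ) := h

/-- The identification `qΛ_W = qΛ_{W/γ}`, which holds because `E_W = E_{W/γ}`. -/
def QuantumState.identify {W : Graph α β} [Finite E(W)] {U : Set α} (γ : Setoid U)
    (ζ : QuantumState W) : QuantumState (identify W γ) := ζ

/-- Bernoulli parameters on `W`, seen on `W/γ`. -/
def identifyParam {W : Graph α β} {U : Set α} (γ : Setoid U)
    (p : E(W) → unitInterval) : E(identify W γ) → unitInterval := p

noncomputable instance (U : Set α) [Finite U] : Fintype (Setoid U) :=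
  @Fintype.ofFinite _ (Finite.of_injective (fun (γ : Setoid U) (x y : U) => γ x y)
    fun _ _ h => Setoid.eq_iff_rel_eq.2 h)

noncomputable instance (U : Set α) : DecidableEq (Setoid U) := Classical.decEq _

open Classical in
/-- The connectivity matrix: the `(γ, γ')` entry is one if the finest common coarsening `γ ⊔ γ'`
of the partitions has a single block, and zero otherwise. -/
noncomputable def connectivityMatrix (U : Set α) : Matrix (Setoid U) (Setoid U) ℝ :=
  Matrix.of fun γ γ' => if (γ ⊔ γ').classes.ncard = 1 then 1 else 0

/-- The matrix `β`, the inverse of the connectivity matrix. -/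
noncomputable def splittingMatrix (U : Set α) [Finite U] : Matrix (Setoid U) (Setoid U) ℝ :=
  (connectivityMatrix U)⁻¹

end QuantumNetwork

/-!
The connectivity of a union of two graphs `K` and `H` with common vertex set `U ≠ ∅` depends only
on the traces that their components leave on `U`: if some component of `K` or `H` misses `U`, the
union is disconnected, and otherwise it is connected if and only if the partitions `a` and `b` of
`U` induced by the components of `K` and `H` have join `⊤`, that is, `α a b = 1`. The graph `K/γ` is
the special case in which `H` is replaced by the relation that identifies the points in each block
of `γ`. Both cases follow from a statement on equivalence relations, `sup_rel_iff`. So the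
indicators of connectivity of `G`, `K/γ` and `H/γ'` are the entries `α a b`, `α a γ` and `α b γ'`,
up to the factors that test whether all components meet `U`, and the identity `α * α⁻¹ * α = α`,
with the symmetry of `α`, splits the connectivity of `G` (`HybridNetwork.connectedIndicator_split`).
As the quantum reliability operator is the projection onto the connected states, all reliabilities
are sums of these indicators against the squared amplitudes, which factor over `Λ_G = Λ_K × Λ_H`.

Invertibility of `α` comes from a factorization `α = Zᵀ * D * Z`, where `Z` is the unitriangular
zeta matrix of the lattice of partitions and `D` is diagonal with entries `μ(z, ⊤)`. These are
nonzero: counting the functions `U → {1, …, n}` that are constant on the blocks of `w` by their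
kernels gives `X ^ |w| = ∑_{z ≥ w} X (X - 1) ⋯ (X - |z| + 1)`, so `μ(z, ⊤)` is the coefficient of
`X` in `X (X - 1) ⋯ (X - |z| + 1)`.
-/

namespace QuantumNetwork

universe u v

variable {α : Type u} {β : Type v}

/-! ### Invertibility of the connectivity matrix -/

open Polynomial in
theorem coeff_one_descPochhammer_ne_zero (n : ℕ) : (descPochhammer ℝ (n + 1)).coeff 1 ≠ 0 := by
  have h : ∀ n : ℕ, (descPochhammer ℝ n).eval (-1) ≠ 0 := fun n => by
    induction n with
    | zero => simp
    | succ n ih =>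
      rw [descPochhammer_succ_eval]
      have : (-1 : ℝ) - n ≠ 0 := by
        have : (0 : ℝ) ≤ n := n.cast_nonneg
        linarith
      exact mul_ne_zero ih this
  rw [descPochhammer_succ_left, coeff_X_mul, coeff_zero_eq_eval_zero, eval_comp]
  simpa using h n

/-- Functions with kernel exactly `z` are embeddings of the set of blocks of `z`. -/
noncomputable def kerEqEquivEmbedding {U : Type*} (z : Setoid U) (T : Type*) :
    {f : U → T // Setoid.ker f = z} ≃ (Quotient z ↪ T) where
  toFun f := ⟨Quotient.lift f.1 fun a b h => by
      have h' : Setoid.ker f.1 a b := by rw [f.2]; exact h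
      exact h', fun a b => by
      induction a, b using Quotient.inductionOn₂ with
      | h a b =>
        intro h
        have h' : Setoid.ker f.1 a b := h
        rw [f.2] at h'
        exact Quotient.sound h'⟩
  invFun g := ⟨fun a => g ⟦a⟧, by
    ext a b
    rw [Setoid.ker_def, g.injective.eq_iff, Quotient.eq]⟩
  left_inv _ := rfl
  right_inv g := by
    ext a
    induction a using Quotient.inductionOn with
    | h a => rfl

/-- The functions `U → Fin n` that are constant on the blocks of `w`, counted by their kernel. -/
theorem sum_descFactorial_eq_pow {U : Type*} [Finite U] [Fintype (Setoid U)] (w : Setoid U)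
    [DecidablePred (w ≤ ·)] (n : ℕ) :
    ∑ z with w ≤ z, n.descFactorial (Nat.card (Quotient z)) = n ^ Nat.card (Quotient w) := by
  classical
  have := Fintype.ofFinite U
  have h1 : Nat.card {f : U → Fin n // w ≤ Setoid.ker f} = n ^ Nat.card (Quotient w) := by
    rw [Nat.card_congr (Setoid.liftEquiv w), Nat.card_fun, Nat.card_fin]
  have h2 (z : Setoid U) : Nat.card {f : U → Fin n // Setoid.ker f = z} =
      n.descFactorial (Nat.card (Quotient z)) := by
    rw [Nat.card_congr (kerEqEquivEmbedding z (Fin n)), Nat.card_eq_fintype_card,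
      Fintype.card_embedding_eq, Fintype.card_fin, Nat.card_eq_fintype_card]
  rw [← h1, Nat.card_eq_fintype_card, Fintype.card_subtype,
    Finset.card_eq_sum_card_fiberwise (f := Setoid.ker) (t := {z | w ≤ z})]
  · refine Finset.sum_congr rfl fun z hz => ?_
    rw [← h2, Nat.card_eq_fintype_card, Fintype.card_subtype, Finset.filter_filter]
    congr 1
    ext f
    simp only [Finset.mem_filter, Finset.mem_univ, true_and] at hz ⊢
    exact ⟨fun h => ⟨h ▸ hz, h⟩, fun h => h.2⟩
  · intro f hf
    simpa using hf

open Polynomial in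
/-- Polynomial form of `sum_descFactorial_eq_pow`: both sides agree at all natural numbers. -/
theorem sum_descPochhammer_eq_X_pow {U : Type*} [Finite U] [Fintype (Setoid U)] (w : Setoid U)
    [DecidablePred (w ≤ ·)] :
    ∑ z with w ≤ z, descPochhammer ℝ (Nat.card (Quotient z)) = X ^ Nat.card (Quotient w) := by
  refine eq_of_infinite_eval_eq _ _
    ((Set.infinite_range_of_injective (Nat.cast_injective (R := ℝ))).mono ?_)
  rintro _ ⟨n, rfl⟩
  rw [Set.mem_ofPred_eq, eval_finsetSum, eval_pow, eval_X, ← Nat.cast_pow,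
    ← sum_descFactorial_eq_pow w n, Nat.cast_sum]
  exact Finset.sum_congr rfl fun z _ => descPochhammer_eval_eq_descFactorial ℝ n _

theorem ncard_classes {U : Type*} (z : Setoid U) : z.classes.ncard = Nat.card (Quotient z) :=
  (Nat.card_congr z.quotientEquivClasses).symm

/-- The value `μ(z, ⊤)` of the Möbius function of the partition lattice, as the coefficient of `X`
in the falling factorial whose degree is the number of blocks of `z`. -/
noncomputable def moebiusTop {U : Type*} (z : Setoid U) : ℝ :=
  (descPochhammer ℝ (Nat.card (Quotient z))).coeff 1

/-- The defining property of `μ(·, ⊤)`, read off from the coefficients of `X` in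
`sum_descPochhammer_eq_X_pow`. -/
theorem sum_moebiusTop {U : Type*} [Finite U] [Fintype (Setoid U)] (w : Setoid U)
    [DecidablePred (w ≤ ·)] :
    ∑ z with w ≤ z, moebiusTop z = if w.classes.ncard = 1 then 1 else 0 := by
  have h := congrArg (Polynomial.coeff · 1) (sum_descPochhammer_eq_X_pow w)
  simp only [Polynomial.finsetSum_coeff, Polynomial.coeff_X_pow] at h
  rw [ncard_classes]
  simpa only [moebiusTop, eq_comm (a := 1)] using h

theorem moebiusTop_ne_zero {U : Type*} [Finite U] [Nonempty U] (z : Setoid U) :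
    moebiusTop z ≠ 0 := by
  have : Nonempty (Quotient z) := Nonempty.map (Quotient.mk z) ‹_›
  obtain ⟨n, hn⟩ := Nat.exists_eq_succ_of_ne_zero (Nat.card_pos (α := Quotient z)).ne'
  rw [moebiusTop, hn]
  exact coeff_one_descPochhammer_ne_zero n

open Classical in
/-- The zeta matrix of a finite order. -/
noncomputable def zetaMatrix (P : Type*) [PartialOrder P] : Matrix P P ℝ :=
  Matrix.of fun z x => if x ≤ z then 1 else 0

/-- The zeta matrix is unitriangular: a vector in its kernel vanishes by induction from below. -/
theorem isUnit_zetaMatrix (P : Type*) [PartialOrder P] [Fintype P] [DecidableEq P] :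
    IsUnit (zetaMatrix P) := by
  classical
  rw [← Matrix.mulVec_injective_iff_isUnit]
  refine (injective_iff_map_eq_zero (Matrix.mulVecLin (zetaMatrix P))).2 fun f hf => ?_
  funext z
  induction z using WellFoundedLT.induction with
  | ind z ih =>
    have h := congrFun hf z
    rw [Matrix.mulVecLin_apply, Matrix.mulVec, dotProduct, Finset.sum_eq_single z] at h
    · simpa [zetaMatrix] using h
    · intro x _ hx
      by_cases hxz : x ≤ z
      · rw [ih x (lt_of_le_of_ne hxz hx), Pi.zero_apply, mul_zero]
      · simp [zetaMatrix, hxz]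
    · simp

/-- Since the entry at `(x, y)` only depends on the join, Möbius inversion over the `z ≥ x ⊔ y`
diagonalizes the connectivity matrix as a bilinear form. -/
theorem connectivityMatrix_eq_mul (U : Set α) [Finite U] :
    connectivityMatrix U =
      (zetaMatrix (Setoid U)).transpose * Matrix.diagonal moebiusTop * zetaMatrix (Setoid U) := by
  classical
  ext x y
  rw [Matrix.mul_apply]
  simp only [Matrix.mul_diagonal, Matrix.transpose_apply, connectivityMatrix, zetaMatrix,
    Matrix.of_apply]
  rw [← sum_moebiusTop, Finset.sum_filter]
  refine Finset.sum_congr rfl fun z _ => ?_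
  by_cases hx : x ≤ z <;> by_cases hy : y ≤ z <;> simp [hx, hy]

theorem isUnit_connectivityMatrix (U : Set α) [Finite U] (hU : U.Nonempty) :
    IsUnit (connectivityMatrix U) := by
  have := hU.to_subtype
  rw [connectivityMatrix_eq_mul]
  have hZ := isUnit_zetaMatrix (Setoid U)
  refine (((Matrix.isUnit_transpose _).2 hZ).mul ?_).mul hZ
  rw [Matrix.isUnit_diagonal, Pi.isUnit_iff]
  exact fun z => (moebiusTop_ne_zero z).isUnit

/-! ### Gluing equivalence relations -/

/-- The partition of `U` into the traces of the classes of `r`. -/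
def trace (r : Setoid α) (U : Set α) : Setoid U := r.comap Subtype.val

/-- Every class of `r` that meets `X` meets `U`. -/
def Meets (r : Setoid α) (X U : Set α) : Prop := ∀ x ∈ X, ∃ u ∈ U, r x u

/-- Relations that only relate distinct points inside `X`. -/
def SupportedOn (r : Setoid α) (X : Set α) : Prop := ∀ x y, r x y → x = y ∨ x ∈ X ∧ y ∈ X

theorem trace_sup_le (r s : Setoid α) (U : Set α) : trace r U ⊔ trace s U ≤ trace (r ⊔ s) U :=
  sup_le (fun _ _ h => (le_sup_left : r ≤ r ⊔ s) h) fun _ _ h => (le_sup_right : s ≤ r ⊔ s) h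

/-- If the join of `r` and `s` has a single class on `X ∪ Y`, an `r`-class contained in `X`
cannot avoid `X ∩ Y`, since it would also be a class of the join. -/
theorem meets_of_sup {r s : Setoid α} {X Y U : Set α} (hr : SupportedOn r X)
    (hs : SupportedOn s Y) (hU : U = X ∩ Y) (hne : U.Nonempty)
    (h : ∀ x ∈ X ∪ Y, ∀ y ∈ X ∪ Y, (r ⊔ s) x y) : Meets r X U := by
  intro x hx
  by_contra! hc
  obtain ⟨u, hu⟩ := hne
  -- If it did avoid `U`, the `r`-class of `x` would be saturated for `s` as well, as it then
  -- contains no point of `Y`.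
  have hle : r ⊔ s ≤ Setoid.ker (r x) := by
    refine sup_le (fun a b hab => ?_) fun a b hab => ?_
    · exact propext ⟨fun h => r.trans' h hab, fun h => r.trans' h (r.symm' hab)⟩
    · obtain rfl | ⟨ha, hb⟩ := hs a b hab
      · rfl
      · have key : ∀ c ∈ Y, ¬ r x c := fun c hcY hxc => by
          have hcX : c ∈ X := by
            obtain rfl | h := hr x c hxc
            exacts [hx, h.2]
          exact hc c (hU ▸ ⟨hcX, hcY⟩) hxc
        exact propext ⟨fun h => (key a ha h).elim, fun h => (key b hb h).elim⟩
  have hxu : (r x x) = (r x u) := hle (h x (Or.inl hx) u (Or.inl (hU ▸ hu : u ∈ X ∩ Y).1))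
  exact hc u hu (hxu ▸ r.refl' x)

/-- The trace of the join is generated by the two traces: a chain of steps of `r` and `s` can only
switch between the two relations at points of `X ∩ Y`. -/
theorem trace_sup_eq {r s : Setoid α} {X Y U : Set α} (hr : SupportedOn r X)
    (hs : SupportedOn s Y) (hU : U = X ∩ Y) : trace (r ⊔ s) U = trace r U ⊔ trace s U := by
  refine le_antisymm (fun a b hab => ?_) (trace_sup_le r s U)
  -- The points joined to `a` through the traces form a set saturated for both relations.
  let S : α → Prop := fun x => ∃ c : U, (trace r U ⊔ trace s U) a c ∧ (r x c ∨ s x c)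
  have key (x : α) (hx : x ∈ U) (hS : S x) : (trace r U ⊔ trace s U) a ⟨x, hx⟩ := by
    obtain ⟨c, hc, h⟩ := hS
    refine Setoid.trans' _ hc (Setoid.symm' _ ?_)
    rcases h with h | h
    · exact (le_sup_left : trace r U ≤ _) (show r x c from h)
    · exact (le_sup_right : trace s U ≤ _) (show s x c from h)
  have hr' : ∀ x y, r x y → S x → S y := by
    rintro x y hxy ⟨c, hc, h | h⟩
    · exact ⟨c, hc, Or.inl (r.trans' (r.symm' hxy) h)⟩
    · obtain rfl | ⟨hxX, hyX⟩ := hr x y hxy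
      · exact ⟨c, hc, Or.inr h⟩
      · have hxU : x ∈ U := by
          obtain rfl | hxc := hs x c h
          exacts [c.2, hU ▸ ⟨hxX, hxc.1⟩]
        exact ⟨⟨x, hxU⟩, key x hxU ⟨c, hc, Or.inr h⟩, Or.inl (r.symm' hxy)⟩
  have hs' : ∀ x y, s x y → S x → S y := by
    rintro x y hxy ⟨c, hc, h | h⟩
    · obtain rfl | ⟨hxY, hyY⟩ := hs x y hxy
      · exact ⟨c, hc, Or.inl h⟩
      · have hxU : x ∈ U := by
          obtain rfl | hxc := hr x c h
          exacts [c.2, hU ▸ ⟨hxc.1, hxY⟩]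
        exact ⟨⟨x, hxU⟩, key x hxU ⟨c, hc, Or.inl h⟩, Or.inr (s.symm' hxy)⟩
    · exact ⟨c, hc, Or.inr (s.trans' (s.symm' hxy) h)⟩
  have hle : r ⊔ s ≤ Setoid.ker S :=
    sup_le (fun x y h => propext ⟨hr' x y h, hr' y x (r.symm' h)⟩)
      fun x y h => propext ⟨hs' x y h, hs' y x (s.symm' h)⟩
  have hab' : S a = S b := hle hab
  have hSb : S b := hab' ▸ ⟨a, Setoid.refl' _ a, Or.inl (r.refl' a)⟩
  exact key b b.2 hSb

/-- The gluing criterion: the join of `r` and `s` has a single class on `X ∪ Y` if and only if all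
classes reach the overlap `U` and the traces of `r` and `s` on `U` have join `⊤`. -/
theorem sup_rel_iff {r s : Setoid α} {X Y U : Set α} (hr : SupportedOn r X)
    (hs : SupportedOn s Y) (hU : U = X ∩ Y) (hne : U.Nonempty) :
    (∀ x ∈ X ∪ Y, ∀ y ∈ X ∪ Y, (r ⊔ s) x y) ↔
      Meets r X U ∧ Meets s Y U ∧ trace r U ⊔ trace s U = ⊤ := by
  constructor
  · refine fun h => ⟨meets_of_sup hr hs hU hne h, ?_, ?_⟩
    · refine meets_of_sup hs hr (hU.trans (Set.inter_comm _ _)) hne ?_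
      rwa [Set.union_comm, sup_comm]
    · rw [← trace_sup_eq hr hs hU, Setoid.eq_top_iff]
      have hUX (u : U) : (u : α) ∈ X ∪ Y := Or.inl (hU ▸ u.2 : (u : α) ∈ X ∩ Y).1
      exact fun x y => h x (hUX x) y (hUX y)
  · rintro ⟨hX, hY, htop⟩
    have hmeet : Meets (r ⊔ s) (X ∪ Y) U := by
      rintro x (hx | hx)
      · obtain ⟨u, hu, hxu⟩ := hX x hx
        exact ⟨u, hu, (le_sup_left : r ≤ _) hxu⟩
      · obtain ⟨u, hu, hxu⟩ := hY x hx
        exact ⟨u, hu, (le_sup_right : s ≤ _) hxu⟩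
    intro x hx y hy
    obtain ⟨a, ha, hxa⟩ := hmeet x hx
    obtain ⟨b, hb, hyb⟩ := hmeet y hy
    have hab : trace (r ⊔ s) U ⟨a, ha⟩ ⟨b, hb⟩ :=
      trace_sup_le r s U (Setoid.eq_top_iff.1 htop ⟨a, ha⟩ ⟨b, hb⟩)
    exact Setoid.trans' _ hxa (Setoid.trans' _ hab (Setoid.symm' _ hyb))

/-! ### Components of graphs -/

/-- The relation of being joined by a path; a point that is not a vertex is related only to
itself. -/
def component (G : Graph α β) : Setoid α where
  r := Relation.ReflTransGen G.Adj
  iseqv := ⟨fun _ => .refl, fun h => by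
    induction h with
    | refl => exact .refl
    | tail _ h ih => exact .head h.symm ih, .trans⟩

theorem component_le_iff {G : Graph α β} {r : Setoid α} :
    component G ≤ r ↔ ∀ x y, G.Adj x y → r x y := by
  refine ⟨fun h x y hxy => h (.single hxy), fun h x y hxy => ?_⟩
  change Relation.ReflTransGen G.Adj x y at hxy
  induction hxy with
  | refl => exact r.refl' x
  | tail _ hbc ih => exact r.trans' ih (h _ _ hbc)

theorem supportedOn_component (G : Graph α β) : SupportedOn (component G) V(G) := by
  intro x y h
  change Relation.ReflTransGen G.Adj x y at h
  induction h with
  | refl => exact Or.inl rfl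
  | tail _ hbc ih =>
    refine Or.inr ⟨?_, hbc.right_mem⟩
    obtain rfl | h := ih
    exacts [hbc.left_mem, h.1]

theorem isConnected_iff {G : Graph α β} (hG : V(G).Nonempty) :
    IsConnected G ↔ ∀ x ∈ V(G), ∀ y ∈ V(G), component G x y :=
  and_iff_right hG

/-- The image of a graph under `f` is connected if and only if any two vertices are linked by
steps along edges and steps between points with the same image. -/
theorem isConnected_map_iff {α' : Type*} {G : Graph α β} (hG : V(G).Nonempty) (f : α → α') :
    IsConnected (G.map f) ↔ ∀ x ∈ V(G), ∀ y ∈ V(G), (component G ⊔ Setoid.ker f) x y := by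
  rw [isConnected_iff (hG.image f)]
  have hle : component G ⊔ Setoid.ker f ≤ (component (G.map f)).comap f := by
    refine sup_le (component_le_iff.2 fun x y h => ?_) fun x y (h : f x = f y) => ?_
    · exact Relation.ReflTransGen.single (h.map f)
    · rw [Setoid.comap_rel, h]
  refine ⟨fun h x hx y hy => ?_, ?_⟩
  · have hxy : Relation.ReflTransGen (G.map f).Adj (f x) (f y) :=
      h _ ⟨x, hx, rfl⟩ _ ⟨y, hy, rfl⟩
    clear hy
    generalize hb : f y = b at hxy
    induction hxy generalizing y with
    | refl => exact (le_sup_right : Setoid.ker f ≤ _) hb.symm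
    | tail _ hbc ih =>
      rw [Graph.map_adj] at hbc
      obtain ⟨v, w, hvw, rfl, rfl⟩ := hbc
      refine Setoid.trans' _ (ih v rfl) (Setoid.trans' _ (y := w) ?_ ?_)
      · exact (le_sup_left : component G ≤ _) (.single hvw)
      · exact (le_sup_right : Setoid.ker f ≤ _) hb.symm
  · rintro h _ ⟨x, hx, rfl⟩ _ ⟨y, hy, rfl⟩
    exact hle (h x hx y hy)

theorem ker_block_iff {U : Set α} {γ : Setoid U} {x y : α} :
    Setoid.ker (block U γ) x y ↔ x = y ∨ ∃ (hx : x ∈ U) (hy : y ∈ U), γ ⟨x, hx⟩ ⟨y, hy⟩ := by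
  rw [Setoid.ker_def]
  constructor
  · intro h
    have hy : y ∈ block U γ x := h ▸ Or.inl rfl
    exact hy.imp_left Eq.symm
  · rintro (rfl | ⟨hx, hy, hxy⟩)
    · rfl
    · ext z
      constructor
      · rintro (rfl | ⟨_, hz, h⟩)
        · exact Or.inr ⟨hy, hx, γ.symm' hxy⟩
        · exact Or.inr ⟨hy, hz, γ.trans' (γ.symm' hxy) h⟩
      · rintro (rfl | ⟨_, hz, h⟩)
        · exact Or.inr ⟨hx, hy, hxy⟩
        · exact Or.inr ⟨hx, hz, γ.trans' hxy h⟩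

theorem supportedOn_ker_block {U : Set α} (γ : Setoid U) :
    SupportedOn (Setoid.ker (block U γ)) U := fun _ _ h =>
  (ker_block_iff.1 h).imp_right fun ⟨hx, hy, _⟩ => ⟨hx, hy⟩

theorem trace_ker_block {U : Set α} (γ : Setoid U) : trace (Setoid.ker (block U γ)) U = γ := by
  ext x y
  refine ker_block_iff.trans ⟨?_, fun h => Or.inr ⟨x.2, y.2, h⟩⟩
  rintro (h | ⟨_, _, h⟩)
  · rw [Subtype.ext h]
  · exact h

/-- `G/γ` is connected if and only if every component of `G` meets `U` and the partition of `U` by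
the components of `G` has join `⊤` with `γ`. -/
theorem isConnected_map_block_iff {G : Graph α β} {U : Set α} (hU : U ⊆ V(G)) (hne : U.Nonempty)
    (γ : Setoid U) :
    IsConnected (G.map (block U γ)) ↔
      Meets (component G) V(G) U ∧ trace (component G) U ⊔ γ = ⊤ := by
  rw [isConnected_map_iff (hne.mono hU)]
  have h := sup_rel_iff (supportedOn_component G) (supportedOn_ker_block γ)
    (Set.inter_eq_self_of_subset_right hU).symm hne
  rw [Set.union_eq_self_of_subset_right hU, trace_ker_block] at h
  have hmeets : Meets (Setoid.ker (block U γ)) U U := fun x hx => ⟨x, hx, rfl⟩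
  rw [h, and_iff_right hmeets]

/-- A graph that is the union of two subgraphs with common vertex set `U` is connected if and only
if all components of the two subgraphs meet `U` and the partitions of `U` that they induce have
join `⊤`. -/
theorem isConnected_union_iff {G K H : Graph α β} {U : Set α} (hV : V(G) = V(K) ∪ V(H))
    (hAdj : ∀ x y, G.Adj x y ↔ K.Adj x y ∨ H.Adj x y) (hU : U = V(K) ∩ V(H)) (hne : U.Nonempty) :
    IsConnected G ↔ Meets (component K) V(K) U ∧ Meets (component H) V(H) U ∧
      trace (component K) U ⊔ trace (component H) U = ⊤ := by
  have hcomp : component G = component K ⊔ component H := by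
    refine le_antisymm (component_le_iff.2 fun x y h => ?_) (sup_le ?_ ?_)
    · rcases (hAdj x y).1 h with h | h
      · exact (le_sup_left : component K ≤ _) (.single h)
      · exact (le_sup_right : component H ≤ _) (.single h)
    · exact component_le_iff.2 fun x y h => .single ((hAdj x y).2 (Or.inl h))
    · exact component_le_iff.2 fun x y h => .single ((hAdj x y).2 (Or.inr h))
  have hGne : V(G).Nonempty := hne.mono fun u hu => hV ▸ Or.inl (hU ▸ hu : u ∈ V(K) ∩ V(H)).1
  rw [isConnected_iff hGne, hcomp, hV]
  exact sup_rel_iff (supportedOn_component K) (supportedOn_component H) hU hne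

/-! ### Reliabilities of identified graphs and of hybrid networks -/

theorem operatingGraph_identify (W : Graph α β) {U : Set α} (γ : Setoid U)
    (ε : ClassicalState W) :
    operatingGraph (identify W γ) ε = (operatingGraph W ε).map (block U γ) := by
  refine Graph.ext rfl fun e x y => ?_
  constructor
  · rintro ⟨he, v, w, h, hv, hw⟩
    exact ⟨v, w, ⟨he, h⟩, hv, hw⟩
  · rintro ⟨v, w, ⟨he, h⟩, hv, hw⟩
    exact ⟨he, v, w, h, hv, hw⟩

open Classical in
/-- The indicator of the connected states. -/
noncomputable def connectedIndicator (W : Graph α β) (ε : ClassicalState W) : ℝ :=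
  if IsConnectedState W ε then 1 else 0

open Classical in
/-- The indicator of the states that are connected in `W/γ`, as a function on `Λ_W`. -/
noncomputable def identifiedIndicator (W : Graph α β) {U : Set α} (γ : Setoid U)
    (ε : ClassicalState W) : ℝ :=
  if IsConnected ((operatingGraph W ε).map (block U γ)) then 1 else 0

theorem connectedIndicator_identify (W : Graph α β) {U : Set α} (γ : Setoid U)
    (ε : ClassicalState (identify W γ)) :
    connectedIndicator (identify W γ) ε = identifiedIndicator W γ ε := by
  unfold connectedIndicator identifiedIndicator
  classical
  exact if_congr (iff_of_eq (congrArg IsConnected (operatingGraph_identify W γ ε))) rfl rfl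

theorem quantumReliability_toState (W : Graph α β) [Finite E(W)] (ψ : UnitVector W) :
    quantumReliability W (toState ψ) =
      ∑ ε, connectedIndicator W ε * ‖(ψ : StateSpace W) ε‖ ^ 2 := by
  have h : reliabilityOperator W = connectedProjection W :=
    (existsUnique_reliabilityOperator W).choose_spec.1.eq_connectedProjection
  rw [quantumReliability, h, expectation_connectedProjection]
  simp only [connectedIndicator, ite_mul, one_mul, zero_mul]

theorem quantumReliability_identify (W : Graph α β) [Finite E(W)] {U : Set α} (γ : Setoid U)
    (ψ : UnitVector W) :
    quantumReliability (identify W γ) (QuantumState.identify γ (toState ψ)) =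
      ∑ ε, identifiedIndicator W γ ε * ‖(ψ : StateSpace W) ε‖ ^ 2 :=
  (quantumReliability_toState (identify W γ) ψ).trans
    (Finset.sum_congr rfl fun ε _ => congrArg (· * _) (connectedIndicator_identify W γ ε))

theorem classicalReliability_eq (W : Graph α β) [Finite E(W)] (p : E(W) → unitInterval) :
    classicalReliability W p = ∑ ε, connectedIndicator W ε * stateProb W p ε := by
  simp only [classicalReliability, connectedIndicator, ite_mul, one_mul, zero_mul]

theorem classicalReliability_identify (W : Graph α β) [Finite E(W)] {U : Set α} (γ : Setoid U)
    (p : E(W) → unitInterval) :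
    classicalReliability (identify W γ) (identifyParam γ p) =
      ∑ ε, identifiedIndicator W γ ε * stateProb W p ε :=
  (classicalReliability_eq (identify W γ) p).trans
    (Finset.sum_congr rfl fun ε _ => congrArg (· * _) (connectedIndicator_identify W γ ε))

theorem normSq_qubitProduct (W : Graph α β) [Finite E(W)] (p : E(W) → unitInterval)
    (z : E(W) → Circle) (ε : ClassicalState W) :
    ‖qubitProduct W p z ε‖ ^ 2 = stateProb W p ε := by
  simp only [qubitProduct, norm_prod, ← Finset.prod_pow, normSq_qubit, stateProb]

open Classical in
/-- The indicator that every component of `W(ε)` meets `U`. -/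
noncomputable def meetsIndicator (W : Graph α β) (U : Set α) (ε : ClassicalState W) : ℝ :=
  if Meets (component (operatingGraph W ε)) V(W) U then 1 else 0

theorem ncard_classes_eq_one_iff {U : Set α} (hU : U.Nonempty) (z : Setoid U) :
    z.classes.ncard = 1 ↔ z = ⊤ := by
  have := hU.to_subtype
  have : Nonempty (Quotient z) := Nonempty.map (Quotient.mk z) ‹_›
  rw [ncard_classes, Nat.card_eq_one_iff_unique, ← Quotient.subsingleton_iff, and_iff_left this]

theorem identifiedIndicator_eq (W : Graph α β) {U : Set α} (hU : U ⊆ V(W))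
    (hne : U.Nonempty) (γ : Setoid U) (ε : ClassicalState W) :
    identifiedIndicator W γ ε = meetsIndicator W U ε *
      connectivityMatrix U (trace (component (operatingGraph W ε)) U) γ := by
  classical
  have h := isConnected_map_block_iff (G := operatingGraph W ε) hU hne γ
  simp only [identifiedIndicator, meetsIndicator, connectivityMatrix, Matrix.of_apply,
    ncard_classes_eq_one_iff hne, h, ite_and, ite_mul, one_mul, zero_mul]
  rfl

theorem connectivityMatrix_comm (U : Set α) (γ γ' : Setoid U) :
    connectivityMatrix U γ γ' = connectivityMatrix U γ' γ := by
  simp only [connectivityMatrix, Matrix.of_apply, sup_comm]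

namespace HybridNetwork

variable (N : HybridNetwork α β)

theorem vertexSet_eq_union (hN : ∀ x ∈ V(N.graph), ∃ e, N.graph.Inc e x) :
    V(N.graph) = V(N.quantumPart) ∪ V(N.classicalPart) := by
  ext x
  constructor
  · intro hx
    obtain ⟨e, he⟩ := hN x hx
    by_cases hq : e ∈ N.quantumEdges
    · exact Or.inl ⟨e, hq, he⟩
    · exact Or.inr ⟨e, ⟨he.edge_mem, hq⟩, he⟩
  · rintro (⟨e, _, he⟩ | ⟨e, _, he⟩) <;> exact he.vertex_mem

theorem adj_operatingGraph_iff (ε : ClassicalState N.graph) (x y : α) :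
    (operatingGraph N.graph ε).Adj x y ↔
      (operatingGraph N.quantumPart (N.restrictQuantum ε)).Adj x y ∨
        (operatingGraph N.classicalPart (N.restrictClassical ε)).Adj x y := by
  constructor
  · rintro ⟨e, ⟨he, hε⟩, hl⟩
    by_cases hq : e ∈ N.quantumEdges
    · exact Or.inl ⟨e, ⟨⟨he, hq⟩, hε⟩, hq, hl⟩
    · exact Or.inr ⟨e, ⟨⟨he, he, hq⟩, hε⟩, ⟨he, hq⟩, hl⟩
  · rintro (⟨e, ⟨he, hε⟩, _, hl⟩ | ⟨e, ⟨he, hε⟩, _, hl⟩)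
    · exact ⟨e, ⟨he.1, hε⟩, hl⟩
    · exact ⟨e, ⟨he.1, hε⟩, hl⟩

theorem connectedIndicator_graph (hN : ∀ x ∈ V(N.graph), ∃ e, N.graph.Inc e x)
    (hU : N.sharingNodes.Nonempty) (ε : ClassicalState N.graph) :
    connectedIndicator N.graph ε =
      meetsIndicator N.quantumPart N.sharingNodes (N.restrictQuantum ε) *
      meetsIndicator N.classicalPart N.sharingNodes (N.restrictClassical ε) *
      connectivityMatrix N.sharingNodes
        (trace (component (operatingGraph N.quantumPart (N.restrictQuantum ε))) N.sharingNodes)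
        (trace (component (operatingGraph N.classicalPart (N.restrictClassical ε)))
          N.sharingNodes) := by
  classical
  have h : IsConnectedState N.graph ε ↔ _ :=
    isConnected_union_iff (G := operatingGraph N.graph ε)
      (K := operatingGraph N.quantumPart (N.restrictQuantum ε))
      (H := operatingGraph N.classicalPart (N.restrictClassical ε)) (N.vertexSet_eq_union hN)
      (N.adj_operatingGraph_iff ε) (U := N.sharingNodes) rfl hU
  simp only [connectedIndicator, meetsIndicator, connectivityMatrix, Matrix.of_apply,
    ncard_classes_eq_one_iff hU, h, ite_and, ite_mul, one_mul, zero_mul]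
  rfl

/-- The connectivity of `G` splits along the sharing nodes. This is the identity
`α * α⁻¹ * α = α` at the partitions induced by the components of the two parts. -/
theorem connectedIndicator_split (hN : ∀ x ∈ V(N.graph), ∃ e, N.graph.Inc e x)
    (hU : N.sharingNodes.Nonempty) (ε : ClassicalState N.graph) :
    connectedIndicator N.graph ε =
      ∑ γ : Setoid N.sharingNodes, ∑ γ' : Setoid N.sharingNodes,
        splittingMatrix N.sharingNodes γ γ' *
          identifiedIndicator N.quantumPart γ (N.restrictQuantum ε) *
          identifiedIndicator N.classicalPart γ' (N.restrictClassical ε) := by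
  have hunit := isUnit_connectivityMatrix N.sharingNodes hU
  have hmul : connectivityMatrix N.sharingNodes * splittingMatrix N.sharingNodes *
      connectivityMatrix N.sharingNodes = connectivityMatrix N.sharingNodes := by
    rw [splittingMatrix, Matrix.mul_nonsing_inv _ ((Matrix.isUnit_iff_isUnit_det _).1 hunit),
      one_mul]
  have hentry (a b : Setoid N.sharingNodes) : connectivityMatrix N.sharingNodes a b =
      ∑ γ, ∑ γ', splittingMatrix N.sharingNodes γ γ' * connectivityMatrix N.sharingNodes a γ *
        connectivityMatrix N.sharingNodes b γ' := by
    conv_lhs => rw [← hmul]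
    simp only [Matrix.mul_apply, Finset.sum_mul]
    rw [Finset.sum_comm]
    refine Finset.sum_congr rfl fun γ _ => Finset.sum_congr rfl fun γ' _ => ?_
    rw [connectivityMatrix_comm _ γ' b]
    ring
  rw [N.connectedIndicator_graph hN hU, hentry, Finset.mul_sum]
  refine Finset.sum_congr rfl fun γ _ => ?_
  rw [Finset.mul_sum]
  refine Finset.sum_congr rfl fun γ' _ => ?_
  rw [identifiedIndicator_eq N.quantumPart (U := N.sharingNodes) Set.inter_subset_left hU,
    identifiedIndicator_eq N.classicalPart (U := N.sharingNodes) Set.inter_subset_right hU]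
  ring

theorem reliability_eq_sum (ψ : UnitVector N.quantumPart)
    (p : E(N.classicalPart) → unitInterval) :
    N.reliability (toState ψ, p) = ∑ ε, connectedIndicator N.graph ε *
      (‖(ψ : StateSpace N.quantumPart) (N.restrictQuantum ε)‖ ^ 2 *
        stateProb N.classicalPart p (N.restrictClassical ε)) := by
  refine (quantumReliability_toState N.graph _).trans (Finset.sum_congr rfl fun ε _ => ?_)
  simp only [tensor, norm_mul, mul_pow, normSq_qubitProduct]

end HybridNetwork

end QuantumNetwork

open QuantumNetwork in
theorem corollary2 {α : Type*} {β : Type*} (N : QuantumNetwork.HybridNetwork α β)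
    (hN : ∀ x ∈ V(N.graph), ∃ e, N.graph.Inc e x)
    (hU : N.sharingNodes.Nonempty) (ζ : N.State) :
    IsUnit (QuantumNetwork.connectivityMatrix N.sharingNodes) ∧
    N.reliability ζ =
      ∑ γ : Setoid N.sharingNodes, ∑ γ' : Setoid N.sharingNodes,
        QuantumNetwork.splittingMatrix N.sharingNodes γ γ' *
          QuantumNetwork.quantumReliability (QuantumNetwork.identify N.quantumPart γ)
            (QuantumNetwork.QuantumState.identify γ ζ.1) *
          QuantumNetwork.classicalReliability (QuantumNetwork.identify N.classicalPart γ')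
            (QuantumNetwork.identifyParam γ' ζ.2) := by
  refine ⟨isUnit_connectivityMatrix _ hU, ?_⟩
  obtain ⟨x, p⟩ := ζ
  induction x using Quotient.inductionOn with
  | h ψ =>
    refine (N.reliability_eq_sum ψ p).trans ?_
    simp only [N.connectedIndicator_split hN hU, Finset.sum_mul]
    rw [Finset.sum_comm]
    refine Finset.sum_congr rfl fun γ _ => ?_
    rw [Finset.sum_comm]
    refine Finset.sum_congr rfl fun γ' _ => ?_
    have hq := quantumReliability_identify N.quantumPart γ ψ
    rw [toState] at hq
    rw [hq, classicalReliability_identify, mul_assoc, Finset.sum_mul_sum, ← Finset.sum_product',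
      Finset.univ_product_univ, Finset.mul_sum]
    refine Fintype.sum_equiv N.stateEquiv _ _ fun ε => ?_
    have h1 : (N.stateEquiv ε).1 = N.restrictQuantum ε := rfl
    have h2 : (N.stateEquiv ε).2 = N.restrictClassical ε := rfl
    rw [h1, h2]
    ring
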